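/- Let $M_{24}$ be the group of permutations of the 24 coordinates that preserve the extended binary Golay code, and let $G=M_{22}$ be the Mathieu group of degree 22, i.e. the pointwise stabilizer of two points in $M_{24}$, acting on the set $\Omega$ of the remaining 22 points. For $0\le k\le 22$, let $\Sigma_k$ denote the partition of the set of all $k$-element subsets of $\Omega$ into the orbits $\{\Delta^g \mid g\in G\}$ of $G$, and write $\Sigma_k=\{b_1,b_2,\dots\}$ for the multiset of the sizes of these orbits, where $b^m$ means that exactly $m$ orbits have size $b$. Then $\Sigma_k$ is trivial, i.e. $\Sigma_k=\{\binom{22}{k}\}$ (a single orbit), for every $k\le 3$. Moreover $$\begin{aligned} \Sigma_4&=\Sigma_{18}=\{1155,\,6160\},\\ \Sigma_5&=\Sigma_{17}=\{462,\,3696^2,\,18480\},\\ \Sigma_6&=\Sigma_{16}=\{77,\,1232^2,\,7392,\,9240,\,55440\},\\ \Sigma_7&=\Sigma_{15}=\{176^2,\,1232,\,2640,\,18480^2,\,55440,\,73920\},\\ \Sigma_8&=\Sigma_{14}=\{330,\,2640^2,\,9240,\,27720,\,36960^2,\,55440,\,73920^2\},\\ \Sigma_9&=\Sigma_{13}=\{4620,\,6160,\,18480^3,\,24640,\,36960^2,\,110880,\,221760\},\\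 \Sigma_{10}&=\Sigma_{12}=\{616,\,2310,\,6160,\,7392^2,\,18480,\,22176,\,27720,\,73920^3,\,110880,\,221760\},\\ \Sigma_{11}&=\{672^2,\,7392^2,\,9240^2,\,27720,\,36960^2,\,44352^2,\,73920^2,\,110880^3\}, \end{aligned}$$ and in general the orbit sizes satisfy $\Sigma_k=\Sigma_{22-k}$ for all $0\le k\le 22$. -/

import Mathlib

open scoped Pointwise

noncomputable section

/-- The set `{Δ ^ g | g ∈ G}` of all images of the subset `Δ` of `Ω` under the elements of `G`. -/
def imagesOf (G : Type*) {Ω : Type*} [Group G] [MulAction G Ω] [Fintype Ω] [DecidableEq Ω]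
    (Δ : Finset Ω) : Finset (Finset Ω) := by
  classical exact Finset.univ.filter (fun Γ => ∃ g : G, g • Δ = Γ)

/-- The partition `Σ_k(G|Ω)` of the set of `k`-element subsets of `Ω`: its parts are the sets
`{Δ ^ g | g ∈ G}`, where `Δ` runs through the `k`-element subsets. -/
def orbitPartition (G : Type*) (Ω : Type*) [Group G] [MulAction G Ω] [Fintype Ω] [DecidableEq Ω]
    (k : ℕ) : Finset (Finset (Finset Ω)) :=
  (Finset.univ.powersetCard k).image (imagesOf G)

/-- The sizes of the parts of `Σ_k(G|Ω)`, with multiplicity. -/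
def orbitSizes (G : Type*) (Ω : Type*) [Group G] [MulAction G Ω] [Fintype Ω] [DecidableEq Ω]
    (k : ℕ) : Multiset ℕ :=
  (orbitPartition G Ω k).val.map Finset.card

/-- The elements of the field with 23 elements that are not nonzero squares:
`0` and the eleven quadratic nonresidues. -/
def nonresidues23 : Finset (ZMod 23) :=
  Finset.univ.filter (fun x => ∀ y : ZMod 23, y ≠ 0 → x ≠ y ^ 2)

/-- The points of the projective line over the field with 23 elements are numbered by `Fin 24`:
`j < 23` stands for the residue class of `j`, and `23` stands for the point at infinity.
This is the characteristic function of the translate `N - i`, where `N` consists of `0` and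
the quadratic nonresidues. -/
def golayWord (i : ZMod 23) : Fin 24 → ZMod 2 :=
  fun j => if (j : ℕ) < 23 ∧ ((j : ℕ) : ZMod 23) + i ∈ nonresidues23 then 1 else 0

/-- The extended binary Golay code, as an extended quadratic residue code: it is spanned by the
translates of `N` and the all-ones word. -/
def golayCode : Submodule (ZMod 2) (Fin 24 → ZMod 2) :=
  Submodule.span (ZMod 2) (insert 1 (Set.range golayWord))

/-- The Mathieu group `M₂₄`: the permutations of the 24 coordinates that preserve the extended
binary Golay code. -/
def mathieuM24 : Subgroup (Equiv.Perm (Fin 24)) where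
  carrier := {σ | ∀ w : Fin 24 → ZMod 2, w ∘ σ ∈ golayCode ↔ w ∈ golayCode}
  one_mem' := fun _ => Iff.rfl
  mul_mem' := fun {σ τ} hσ hτ w => (hτ (w ∘ σ)).trans (hσ w)
  inv_mem' := fun {σ} hσ w => by
    have h : (w ∘ (σ⁻¹ : Equiv.Perm (Fin 24))) ∘ σ = w := by
      funext x
      simp
    have h2 := hσ (w ∘ (σ⁻¹ : Equiv.Perm (Fin 24)))
    rw [h] at h2
    exact h2.symm

/-- The Mathieu group `M₂₂` of degree 22: the pointwise stabilizer of the last two of the 24 points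
in `M₂₄`, acting on the remaining 22 points. That is, a permutation of the first 22 points belongs
to it when its extension by the identity to all 24 points lies in `M₂₄`. -/
def mathieuM22 : Subgroup (Equiv.Perm (Fin 22)) :=
  mathieuM24.comap (Equiv.Perm.viaEmbeddingHom (Fin.castAddEmb 2 : Fin 22 ↪ Fin 24))

end

/-!
The orbits of `M₂₂` on `k`-subsets, for `k ≤ 11`, are found by induction on `k`, without use of the
order of the group; for `k ≥ 12` one passes to complements (`orbitSizes_compl`).

Two facts about the Golay code carry the argument. Some explicit permutations preserve it
(`exists_smul_of_mem_generators`), which bounds the number of orbits from above. And the group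
permutes the 176 heptads, the octads through one of the two fixed points and not the other with
that point removed, so that the distribution of the intersection numbers of `Δ` with the heptads
is constant on orbits; it is summarized in the number `heptadSum Δ`, which bounds the number of
orbits from below.

For the step from `k` to `k + 1`, let representatives `Δ` of the orbits on `k`-subsets be given,
together with the sizes of these orbits. Each `(k + 1)`-subset is equivalent to some
`Δ ∪ {x}`, and for each of these a word in the permutations above is recorded that carries it to a
member of a list of proposed representatives. So this list meets all orbits, and it meets each
only once if `heptadSum` takes different values on its members (`orbitPartition_succ`). The words
also tell how many points `x` take `Δ` into the orbit of a given representative `Γ`, and counting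
the pairs of a member of that orbit and a `k`-subset of it in two ways gives
`(k + 1) * #(orbit of Γ) = ∑ #(orbit of Δ) * #{x | Δ ∪ {x} in the orbit of Γ}`
(`card_mul_card_imagesOf_eq_sum`), which determines the size of the orbit of `Γ`.

For the finite verifications, subsets of the 22 points and words of length 24 are encoded as the
natural numbers whose binary digits are their characteristic functions, and membership in the Golay
code is tested by reduction modulo an echelon basis (`golayCode_eq_maskSpan`).
-/

/-! ### Bit masks -/

/-- `f n`, arranged so that the kernel evaluates `n` to a numeral before it substitutes it
into `f`. -/
def strict {α : Type*} (n : ℕ) (f : ℕ → α) : α :=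
  match n with
  | 0 => f 0
  | k + 1 => f (k + 1)

@[simp]
theorem strict_eq {α : Type*} (n : ℕ) (f : ℕ → α) : strict n f = f n := by
  cases n <;> rfl

/-- The number of ones among the `k` lowest binary digits of `n`. -/
def popcount : ℕ → ℕ → ℕ
  | 0, _ => 0
  | k + 1, n => n % 2 + strict (n / 2) (popcount k)

theorem card_filter_testBit (k n : ℕ) :
    (Finset.univ.filter (fun i : Fin k => n.testBit i)).card = popcount k n := by
  induction k generalizing n with
  | zero => simp [popcount]
  | succ k ih =>
    rw [Fin.card_filter_univ_succ]
    have h : (Finset.univ.filter (fun i : Fin k => n.testBit (i.succ : Fin (k + 1)))).card =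
        popcount k (n / 2) := by
      rw [← ih (n / 2)]
      simp [Nat.testBit_succ]
    rw [h]
    simp only [popcount, strict_eq, Fin.val_zero, Nat.testBit_zero, decide_eq_true_eq]
    rcases Nat.mod_two_eq_zero_or_one n with h0 | h0 <;> simp [h0]; omega

/-- The image of the bit mask `n` under the map of positions `j ↦ ts[j]`; digits beyond the length
of the table are dropped. -/
def actMask : List ℕ → ℕ → ℕ
  | [], _ => 0
  | t :: ts, n => (n % 2) <<< t ||| strict (n / 2) (actMask ts)

theorem testBit_actMask (ts : List ℕ) (n i : ℕ) :
    (actMask ts n).testBit i = true ↔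
      ∃ j, ∃ h : j < ts.length, n.testBit j = true ∧ ts[j] = i := by
  induction ts generalizing n with
  | nil => simp [actMask]
  | cons t ts ih =>
    have h0 : ((n % 2) <<< t).testBit i = true ↔ n.testBit 0 = true ∧ t = i := by
      rw [Nat.testBit_shiftLeft, Nat.testBit_zero]
      rcases Nat.mod_two_eq_zero_or_one n with h | h
      · simp [h]
      · simp only [h, Nat.testBit_one_eq_true_iff_self_eq_zero, Bool.and_eq_true,
          decide_eq_true_eq, true_and]
        omega
    rw [actMask, strict_eq, Nat.testBit_or, Bool.or_eq_true, h0, ih]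
    constructor
    · rintro (⟨h1, h2⟩ | ⟨j, hj, h1, h2⟩)
      · exact ⟨0, by simp, h1, h2⟩
      · exact ⟨j + 1, by simpa using hj, by rwa [Nat.testBit_succ], by simpa using h2⟩
    · rintro ⟨j, hj, h1, h2⟩
      cases j with
      | zero => exact Or.inl ⟨h1, h2⟩
      | succ j =>
        exact Or.inr ⟨j, by simpa using hj, by rwa [Nat.testBit_succ] at h1, by simpa using h2⟩

/-- For a table without repetitions, the digits are merely moved. -/
theorem testBit_actMask_getElem {ts : List ℕ} (hts : ts.Nodup) (n : ℕ) {j : ℕ}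
    (hj : j < ts.length) : (actMask ts n).testBit ts[j] = n.testBit j := by
  rw [Bool.eq_iff_iff, testBit_actMask]
  constructor
  · rintro ⟨i, hi, h1, h2⟩
    rwa [(hts.getElem_inj_iff).1 h2] at h1
  · exact fun h => ⟨j, hj, h, rfl⟩

/-- The set of points encoded by a bit mask; only the 22 lowest digits matter. -/
def maskSet (n : ℕ) : Finset (Fin 22) :=
  Finset.univ.filter (fun i => n.testBit i)

@[simp]
theorem mem_maskSet {n : ℕ} {i : Fin 22} : i ∈ maskSet n ↔ n.testBit i = true := by
  simp [maskSet]

theorem card_maskSet (n : ℕ) : (maskSet n).card = popcount 22 n :=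
  card_filter_testBit 22 n

theorem maskSet_inter (m n : ℕ) : maskSet m ∩ maskSet n = maskSet (m &&& n) := by
  ext i
  simp

theorem maskSet_insert (m : ℕ) (x : Fin 22) :
    insert x (maskSet m) = maskSet (m ||| 1 <<< (x : ℕ)) := by
  ext i
  rw [Finset.mem_insert, mem_maskSet, mem_maskSet, Nat.testBit_or, Nat.one_shiftLeft,
    Nat.testBit_two_pow, Bool.or_eq_true, decide_eq_true_eq, Fin.ext_iff]
  tauto

/-- The binary word of length 24 encoded by a bit mask. -/
def maskWord (n : ℕ) : Fin 24 → ZMod 2 :=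
  fun j => if n.testBit j then 1 else 0

theorem maskWord_xor (m n : ℕ) : maskWord (m ^^^ n) = maskWord m + maskWord n := by
  funext j
  simp only [maskWord, Nat.testBit_xor, Pi.add_apply]
  cases m.testBit j <;> cases n.testBit j <;> simp
  decide

@[simp]
theorem maskWord_zero : maskWord 0 = 0 := by
  funext j
  simp [maskWord]

theorem maskWord_eq_one_iff {n : ℕ} {j : Fin 24} : maskWord n j = 1 ↔ n.testBit j = true := by
  simp [maskWord]

/-! ### Elimination over the field with two elements -/

/-- The subspace spanned by the words that a list of bit masks encodes. -/
def maskSpan (B : List ℕ) : Submodule (ZMod 2) (Fin 24 → ZMod 2) :=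
  Submodule.span (ZMod 2) {w | ∃ b ∈ B, maskWord b = w}

theorem maskWord_mem_maskSpan {B : List ℕ} {b : ℕ} (h : b ∈ B) : maskWord b ∈ maskSpan B :=
  Submodule.subset_span ⟨b, h, rfl⟩

theorem maskSpan_le {B : List ℕ} {C : Submodule (ZMod 2) (Fin 24 → ZMod 2)} :
    maskSpan B ≤ C ↔ ∀ b ∈ B, maskWord b ∈ C := by
  rw [maskSpan, Submodule.span_le]
  constructor
  · exact fun h b hb => h ⟨b, hb, rfl⟩
  · rintro h _ ⟨b, hb, rfl⟩
    exact h b hb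

/-- Reduction of `n` modulo `B`: each member of `B` is added if this makes the number smaller,
that is, if it clears the leading digit of that member. -/
def reduceMask : List ℕ → ℕ → ℕ
  | [], n => n
  | b :: B, n => strict (min n (n ^^^ b)) (reduceMask B)

theorem maskWord_mem_iff_reduceMask {C : Submodule (ZMod 2) (Fin 24 → ZMod 2)} {B : List ℕ}
    (hB : ∀ b ∈ B, maskWord b ∈ C) (n : ℕ) :
    maskWord n ∈ C ↔ maskWord (reduceMask B n) ∈ C := by
  induction B generalizing n with
  | nil => rfl
  | cons b B ih =>
    rw [reduceMask, strict_eq, ← ih fun c hc => hB c (by simp [hc])]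
    rcases min_choice n (n ^^^ b) with h | h
    · rw [h]
    · rw [h, maskWord_xor, Submodule.add_mem_iff_left _ (hB b (by simp))]

theorem maskWord_mem_of_reduceMask_eq_zero {B : List ℕ} {n : ℕ} (h : reduceMask B n = 0) :
    maskWord n ∈ maskSpan B := by
  rw [maskWord_mem_iff_reduceMask (fun b hb => maskWord_mem_maskSpan hb), h, maskWord_zero]
  exact zero_mem _

/-- Gaussian elimination: the nonzero remainders of the members of `V`, each reduced modulo
the earlier ones (and modulo the start list `B`). -/
def xorBasis : List ℕ → List ℕ → List ℕ
  | B, [] => B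
  | B, v :: V => strict (reduceMask B v) fun r => if r = 0 then xorBasis B V else
      xorBasis (B ++ [r]) V

theorem maskSpan_xorBasis (B V : List ℕ) : maskSpan (xorBasis B V) = maskSpan (B ++ V) := by
  induction V generalizing B with
  | nil => simp [xorBasis]
  | cons v V ih =>
    have hB : ∀ b ∈ B, ∀ {C}, B ⊆ C → maskWord b ∈ maskSpan C :=
      fun b hb C hC => maskWord_mem_maskSpan (hC hb)
    rw [xorBasis, strict_eq]
    split_ifs with h
    · rw [ih]
      apply le_antisymm
      · rw [maskSpan_le]
        intro b hb
        exact maskWord_mem_maskSpan (by simp at hb ⊢; tauto)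
      · rw [maskSpan_le]
        intro b hb
        rcases List.mem_append.1 hb with hb | hb
        · exact maskWord_mem_maskSpan (by simp [hb])
        rcases List.mem_cons.1 hb with rfl | hb
        · rw [maskWord_mem_iff_reduceMask (B := B) fun c hc => hB c hc (by simp), h, maskWord_zero]
          exact zero_mem _
        · exact maskWord_mem_maskSpan (by simp [hb])
    · rw [ih]
      apply le_antisymm
      · rw [maskSpan_le]
        intro b hb
        simp only [List.append_assoc, List.mem_append, List.mem_cons, List.not_mem_nil,
          or_false] at hb
        rcases hb with hb | rfl | hb
        · exact maskWord_mem_maskSpan (by simp [hb])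
        · rw [← maskWord_mem_iff_reduceMask (B := B) fun c hc => hB c hc (by simp)]
          exact maskWord_mem_maskSpan (by simp)
        · exact maskWord_mem_maskSpan (by simp [hb])
      · rw [maskSpan_le]
        intro b hb
        simp only [List.mem_append, List.mem_cons] at hb
        rcases hb with hb | rfl | hb
        · exact maskWord_mem_maskSpan (by simp [hb])
        · rw [maskWord_mem_iff_reduceMask (B := B) fun c hc => hB c hc (by simp)]
          exact maskWord_mem_maskSpan (by simp)
        · exact maskWord_mem_maskSpan (by simp [hb])

/-- All sums of members of a list of bit masks. -/
def xorClosure : List ℕ → List ℕ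
  | [] => [0]
  | b :: B => xorClosure B ++ (xorClosure B).map (b ^^^ ·)

theorem mem_maskSpan_iff {B : List ℕ} {w : Fin 24 → ZMod 2} :
    w ∈ maskSpan B ↔ ∃ n ∈ xorClosure B, maskWord n = w := by
  induction B generalizing w with
  | nil => simp [maskSpan, xorClosure, eq_comm]
  | cons b B ih =>
    have hspan : maskSpan (b :: B) = Submodule.span (ZMod 2) {maskWord b} ⊔ maskSpan B := by
      rw [maskSpan, maskSpan, ← Submodule.span_insert]
      congr 1
      ext w
      simp [eq_comm]
    rw [hspan, Submodule.mem_sup]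
    simp only [Submodule.mem_span_singleton, xorClosure, List.mem_append, List.mem_map]
    constructor
    · rintro ⟨_, ⟨a, rfl⟩, z, hz, rfl⟩
      obtain ⟨n, hn, rfl⟩ := ih.1 hz
      obtain rfl | rfl : a = 0 ∨ a = 1 := by revert a; decide
      · exact ⟨n, Or.inl hn, by simp⟩
      · exact ⟨b ^^^ n, Or.inr ⟨n, hn, rfl⟩, by simp [maskWord_xor]⟩
    · rintro ⟨_, hn | ⟨n, hn, rfl⟩, rfl⟩
      · exact ⟨0, ⟨0, by simp⟩, _, ih.2 ⟨_, hn, rfl⟩, by simp⟩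
      · exact ⟨maskWord b, ⟨1, by simp⟩, _, ih.2 ⟨n, hn, rfl⟩, by rw [maskWord_xor]⟩

/-! ### The Golay code -/

/-- Bit masks of the words that span the Golay code: the all-ones word, and the 23 cyclic shifts
of the characteristic function of the set `{0, 5, 7, 10, 11, 14, 15, 17, 19, 20, 21, 22}` that
consists of `0` and the quadratic nonresidues modulo 23, whose bit mask is `8047777`. The shifts are
cut out of two consecutive copies of that mask. -/
def golayGenerators : List ℕ :=
  (2 ^ 24 - 1) :: (List.range 23).map fun i =>
    ((8047777 <<< 23 ||| 8047777) >>> i) % 2 ^ 23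

theorem mem_nonresidues23 :
    ∀ x : ZMod 23, x ∈ nonresidues23 ↔ Nat.testBit 8047777 x.val = true := by
  decide +kernel

theorem golayWord_eq_maskWord : ∀ i : ZMod 23,
    golayWord i = maskWord (((8047777 <<< 23 ||| 8047777) >>> i.val) % 2 ^ 23) := by
  have h : ∀ i : ZMod 23, ∀ j : Fin 24,
      ((j : ℕ) < 23 ∧ Nat.testBit 8047777 (((j : ℕ) : ZMod 23) + i).val = true) ↔
      Nat.testBit (((8047777 <<< 23 ||| 8047777) >>> i.val) % 2 ^ 23) j = true := by
    decide +kernel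
  intro i
  funext j
  simp only [golayWord, maskWord, mem_nonresidues23, h]

/-- An echelon basis of the Golay code. -/
def golayBasis : List ℕ :=
  [16777215, 8047777, 502513, 3742169, 1635173, 525883, 31892, 15946, 7973, 231185, 102084, 34236]

theorem xorBasis_golayGenerators : xorBasis [] golayGenerators = golayBasis := by
  decide +kernel

theorem golayCode_eq_maskSpan : golayCode = maskSpan golayBasis := by
  rw [← xorBasis_golayGenerators, maskSpan_xorBasis, golayCode, maskSpan]
  congr 1
  ext w
  simp only [Set.mem_insert_iff, Set.mem_range, List.nil_append, golayGenerators, List.mem_cons,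
    List.mem_map, List.mem_range, Set.mem_ofPred_eq]
  have h1 : maskWord (2 ^ 24 - 1) = 1 := by
    funext j
    simp [maskWord, Nat.testBit_two_pow_sub_one, -Nat.reducePow, -Nat.reduceSub]
  constructor
  · rintro (rfl | ⟨i, rfl⟩)
    · exact ⟨_, Or.inl rfl, h1⟩
    · exact ⟨_, Or.inr ⟨i.val, ZMod.val_lt i, rfl⟩, (golayWord_eq_maskWord i).symm⟩
  · rintro ⟨_, rfl | ⟨i, hi, rfl⟩, rfl⟩
    · exact Or.inl h1
    · refine Or.inr ⟨(i : ZMod 23), ?_⟩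
      rw [golayWord_eq_maskWord, ZMod.val_natCast_of_lt hi]

/-! ### Orbits on subsets -/

section Orbits

variable {G Ω : Type*} [Group G] [MulAction G Ω] [Fintype Ω] [DecidableEq Ω]

theorem mem_imagesOf {Δ Γ : Finset Ω} : Γ ∈ imagesOf G Δ ↔ ∃ g : G, g • Δ = Γ := by
  simp [imagesOf]

theorem self_mem_imagesOf (Δ : Finset Ω) : Δ ∈ imagesOf G Δ :=
  mem_imagesOf.2 ⟨1, one_smul _ _⟩

theorem imagesOf_smul (g : G) (Δ : Finset Ω) : imagesOf G (g • Δ) = imagesOf G Δ := by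
  ext Γ
  rw [mem_imagesOf, mem_imagesOf]
  constructor
  · rintro ⟨h, rfl⟩
    exact ⟨h * g, mul_smul _ _ _⟩
  · rintro ⟨h, rfl⟩
    exact ⟨h * g⁻¹, by rw [mul_smul, inv_smul_smul]⟩

theorem imagesOf_eq_iff {Δ Γ : Finset Ω} : imagesOf G Δ = imagesOf G Γ ↔ Δ ∈ imagesOf G Γ := by
  constructor
  · intro h
    rw [← h]
    exact self_mem_imagesOf Δ
  · intro h
    obtain ⟨g, rfl⟩ := mem_imagesOf.1 h
    exact imagesOf_smul g Γ

theorem card_of_mem_imagesOf {Δ Γ : Finset Ω} (h : Γ ∈ imagesOf G Δ) : Γ.card = Δ.card := by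
  obtain ⟨g, rfl⟩ := mem_imagesOf.1 h
  exact Finset.card_smul_finset g Δ

theorem compl_smul_finset (g : G) (Δ : Finset Ω) : (g • Δ)ᶜ = g • Δᶜ := by
  ext x
  simp [← Finset.inv_smul_mem_iff]

theorem imagesOf_compl (Δ : Finset Ω) :
    imagesOf G Δᶜ = (imagesOf G Δ).map ⟨compl, compl_injective⟩ := by
  ext Γ
  simp only [mem_imagesOf, Finset.mem_map, Function.Embedding.coeFn_mk]
  constructor
  · rintro ⟨g, rfl⟩
    exact ⟨g • Δ, ⟨g, rfl⟩, compl_smul_finset g Δ⟩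
  · rintro ⟨_, ⟨g, rfl⟩, rfl⟩
    exact ⟨g, (compl_smul_finset g Δ).symm⟩

/-- Taking complements carries the orbits on `k`-subsets to those on the subsets with `k` points
fewer than all. -/
theorem orbitSizes_compl {k : ℕ} (hk : k ≤ Fintype.card Ω) :
    orbitSizes G Ω k = orbitSizes G Ω (Fintype.card Ω - k) := by
  have h : orbitPartition G Ω (Fintype.card Ω - k) = (orbitPartition G Ω k).map
      ⟨fun O => O.map ⟨compl, compl_injective⟩, Finset.map_injective _⟩ := by
    ext O
    simp only [orbitPartition, Finset.mem_map, Finset.mem_image, Finset.mem_powersetCard_univ,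
      Function.Embedding.coeFn_mk]
    constructor
    · rintro ⟨Δ, hΔ, rfl⟩
      refine ⟨_, ⟨Δᶜ, ?_, rfl⟩, ?_⟩
      · rw [Finset.card_compl, hΔ]
        omega
      · rw [← imagesOf_compl, compl_compl]
    · rintro ⟨_, ⟨Δ, hΔ, rfl⟩, rfl⟩
      exact ⟨Δᶜ, by rw [Finset.card_compl, hΔ], imagesOf_compl Δ⟩
  rw [orbitSizes, orbitSizes, h, Finset.map_val, Multiset.map_map]
  simp

/-- A sum over all `k`-subsets of a function that is constant on orbits, collected by orbits. -/
theorem sum_powersetCard_eq_sum_orbitPartition (k : ℕ) (f : Finset Ω → ℕ) :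
    ∑ Δ ∈ Finset.univ.powersetCard k, f Δ = ∑ O ∈ orbitPartition G Ω k, ∑ Δ ∈ O, f Δ := by
  rw [← Finset.sum_fiberwise_of_maps_to (t := orbitPartition G Ω k) (g := imagesOf G)
    fun Δ hΔ => Finset.mem_image_of_mem _ hΔ]
  refine Finset.sum_congr rfl fun O hO => Finset.sum_congr ?_ fun _ _ => rfl
  obtain ⟨Γ, hΓ, rfl⟩ := Finset.mem_image.1 hO
  ext Δ
  rw [Finset.mem_filter, imagesOf_eq_iff, Finset.mem_powersetCard_univ]
  rw [Finset.mem_powersetCard_univ] at hΓ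
  exact ⟨fun h => h.2, fun h => ⟨(card_of_mem_imagesOf h).trans hΓ, h⟩⟩

variable (G) in
/-- The number of points that enlarge `Δ` to a member of the orbit of `Γ`. -/
noncomputable def extensionCount (Δ Γ : Finset Ω) : ℕ :=
  (Finset.univ.filter fun x => x ∉ Δ ∧ insert x Δ ∈ imagesOf G Γ).card

theorem insert_smul_mem_imagesOf (g : G) (x : Ω) (Δ Γ : Finset Ω) :
    insert (g • x) (g • Δ) ∈ imagesOf G Γ ↔ insert x Δ ∈ imagesOf G Γ := by
  rw [← Finset.smul_finset_insert, ← imagesOf_eq_iff, imagesOf_smul, imagesOf_eq_iff]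

theorem extensionCount_smul (g : G) (Δ Γ : Finset Ω) :
    extensionCount G (g • Δ) Γ = extensionCount G Δ Γ := by
  symm
  refine Finset.card_bij (fun x _ => g • x) ?_ ?_ ?_
  · intro x hx
    simp only [Finset.mem_filter, Finset.mem_univ, true_and] at hx ⊢
    rwa [Finset.smul_mem_smul_finset_iff, insert_smul_mem_imagesOf]
  · intro x _ y _ h
    exact MulAction.injective g h
  · intro y hy
    refine ⟨g⁻¹ • y, ?_, smul_inv_smul g y⟩
    simp only [Finset.mem_filter, Finset.mem_univ, true_and] at hy ⊢
    rwa [← Finset.smul_mem_smul_finset_iff g, ← insert_smul_mem_imagesOf g, smul_inv_smul]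

/-- Double counting of the pairs `Δ' ⊂ Γ'` in which `Γ'` belongs to the orbit of `Γ` and `Δ'` has
one point less. -/
theorem card_mul_card_imagesOf {k : ℕ} {Γ : Finset Ω} (hΓ : Γ.card = k + 1) :
    (k + 1) * (imagesOf G Γ).card =
      ∑ Δ ∈ Finset.univ.powersetCard k, extensionCount G Δ Γ := by
  have h := Finset.sum_card_bipartiteAbove_eq_sum_card_bipartiteBelow
    (s := Finset.univ.powersetCard k) (t := imagesOf G Γ) (fun Δ' Γ' : Finset Ω => Δ' ⊆ Γ')
  have h1 : ∀ Γ' ∈ imagesOf G Γ, (Finset.bipartiteBelow (fun Δ' Γ' : Finset Ω => Δ' ⊆ Γ')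
      (Finset.univ.powersetCard k) Γ').card = k + 1 := by
    intro Γ' hΓ'
    have : Finset.bipartiteBelow (fun Δ' Γ' : Finset Ω => Δ' ⊆ Γ')
        (Finset.univ.powersetCard k) Γ' = Γ'.powersetCard k := by
      ext Δ'
      simp [Finset.mem_powersetCard, and_comm, Finset.bipartiteBelow]
    rw [this, Finset.card_powersetCard, card_of_mem_imagesOf hΓ', hΓ, Nat.choose_succ_self_right]
  rw [Finset.sum_congr rfl h1, Finset.sum_const, smul_eq_mul, mul_comm] at h
  rw [← h]
  refine Finset.sum_congr rfl fun Δ hΔ => ?_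
  rw [Finset.mem_powersetCard_univ] at hΔ
  symm
  refine Finset.card_bij (fun x _ => insert x Δ) ?_ ?_ ?_
  · intro x hx
    simp only [Finset.mem_filter, Finset.mem_univ, true_and] at hx
    exact Finset.mem_filter.2 ⟨hx.2, Finset.subset_insert _ _⟩
  · intro x hx y hy hxy
    simp only [Finset.mem_filter, Finset.mem_univ, true_and] at hx hy
    exact (Finset.insert_inj hx.1).1 hxy
  · intro Γ' hΓ'
    obtain ⟨h2, h3⟩ := Finset.mem_filter.1 hΓ'
    obtain ⟨x, hx, rfl⟩ := (Finset.covBy_iff_exists_insert (s := Δ) (t := Γ')).1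
      (Finset.covBy_iff_card_sdiff_eq_one.2
        ⟨h3, by rw [Finset.card_sdiff_of_subset h3, card_of_mem_imagesOf h2, hΓ, hΔ]; omega⟩)
    exact ⟨x, by simp [hx, h2], rfl⟩

theorem card_mul_card_imagesOf_eq_sum {k : ℕ} {Γ : Finset Ω} (hΓ : Γ.card = k + 1)
    {L : List (Finset Ω)} (hL : (orbitPartition G Ω k).val = L.map (imagesOf G)) :
    (k + 1) * (imagesOf G Γ).card =
      (L.map fun Δ => (imagesOf G Δ).card * extensionCount G Δ Γ).sum := by
  rw [card_mul_card_imagesOf hΓ, sum_powersetCard_eq_sum_orbitPartition (G := G)]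
  rw [Finset.sum_eq_multiset_sum, hL, Multiset.map_coe, Multiset.sum_coe, List.map_map]
  congr 1
  refine List.map_congr_left fun Δ _ => ?_
  have h : ∀ Δ' ∈ imagesOf G Δ, extensionCount G Δ' Γ = extensionCount G Δ Γ := by
    intro Δ' h
    obtain ⟨g, rfl⟩ := mem_imagesOf.1 h
    exact extensionCount_smul g Δ Γ
  simp only [Function.comp_apply]
  rw [Finset.sum_congr rfl h, Finset.sum_const, smul_eq_mul]

/-- If the sets of a list lie in different orbits, and each `(k + 1)`-set that arises from a
representative of an orbit on `k`-sets by adding a point lies in the orbit of a set of the list,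
then the list represents the orbits on `(k + 1)`-sets. -/
theorem orbitPartition_succ {k : ℕ} {L L' : List (Finset Ω)}
    (hL : (orbitPartition G Ω k).val = L.map (imagesOf G))
    (hcard : ∀ Γ ∈ L', Γ.card = k + 1) (hnodup : (L'.map (imagesOf G)).Nodup)
    (hext : ∀ Δ ∈ L, ∀ x ∉ Δ, ∃ Γ ∈ L', insert x Δ ∈ imagesOf G Γ) :
    (orbitPartition G Ω (k + 1)).val = L'.map (imagesOf G) := by
  have : orbitPartition G Ω (k + 1) = ⟨L'.map (imagesOf G), Multiset.coe_nodup.2 hnodup⟩ := by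
    ext O
    simp only [orbitPartition, Finset.mem_image, Finset.mem_powersetCard_univ, Finset.mem_mk,
      Multiset.mem_coe, List.mem_map]
    constructor
    · rintro ⟨Γ, hΓ, rfl⟩
      obtain ⟨x, Δ, hx, rfl, hΔ⟩ := Finset.card_eq_succ.1 hΓ
      have hmem : imagesOf G Δ ∈ (orbitPartition G Ω k).val :=
        Finset.mem_image_of_mem _ (Finset.mem_powersetCard_univ.2 hΔ)
      rw [hL, Multiset.mem_coe, List.mem_map] at hmem
      obtain ⟨Δ₀, hΔ₀, h⟩ := hmem
      obtain ⟨g, rfl⟩ := mem_imagesOf.1 (imagesOf_eq_iff.1 h.symm)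
      obtain ⟨Γ, hΓ, h2⟩ := hext Δ₀ hΔ₀ (g⁻¹ • x)
        (by rwa [← Finset.smul_mem_smul_finset_iff g, smul_inv_smul])
      refine ⟨Γ, hΓ, ?_⟩
      rw [← insert_smul_mem_imagesOf g, smul_inv_smul] at h2
      exact (imagesOf_eq_iff.2 h2).symm
    · rintro ⟨Γ, hΓ, rfl⟩
      exact ⟨Γ, hcard Γ hΓ, rfl⟩
  rw [this]

theorem orbitPartition_zero : (orbitPartition G Ω 0).val = [(∅ : Finset Ω)].map (imagesOf G) := by
  simp [orbitPartition]

theorem orbitSizes_eq {k : ℕ} {L : List (Finset Ω)}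
    (hL : (orbitPartition G Ω k).val = L.map (imagesOf G)) :
    orbitSizes G Ω k = L.map fun Δ => (imagesOf G Δ).card := by
  rw [orbitSizes, hL, Multiset.map_coe, List.map_map]
  rfl

end Orbits

/-! ### Elements of the Mathieu groups -/

theorem mem_mathieuM24_of_golayBasis {e : Equiv.Perm (Fin 24)}
    (h : ∀ b ∈ golayBasis, ∃ c, maskWord c ∈ golayCode ∧ maskWord c ∘ e = maskWord b) :
    e ∈ mathieuM24 := by
  let φ := LinearEquiv.funCongrLeft (ZMod 2) (ZMod 2) e
  have hle : golayCode ≤ golayCode.map (φ : (Fin 24 → ZMod 2) →ₗ[ZMod 2] Fin 24 → ZMod 2) := by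
    conv_lhs => rw [golayCode_eq_maskSpan]
    rw [maskSpan_le]
    intro b hb
    obtain ⟨c, hc, hcb⟩ := h b hb
    exact ⟨maskWord c, hc, hcb⟩
  have heq := Submodule.eq_of_le_of_finrank_eq hle (LinearEquiv.finrank_map_eq φ golayCode).symm
  intro w
  constructor
  · intro hw
    rw [heq] at hw
    obtain ⟨v, hv, hvw⟩ := hw
    have : v = w := φ.injective hvw
    rwa [← this]
  · intro hw
    rw [heq]
    exact ⟨w, hw, rfl⟩

/-- The extension of a permutation of the first 22 points by the identity to all 24 points. -/
noncomputable def extendPerm (σ : Equiv.Perm (Fin 22)) : Equiv.Perm (Fin 24) :=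
  Equiv.Perm.viaEmbeddingHom (Fin.castAddEmb 2 : Fin 22 ↪ Fin 24) σ

theorem extendPerm_castAdd (σ : Equiv.Perm (Fin 22)) (i : Fin 22) :
    extendPerm σ (Fin.castAdd 2 i) = Fin.castAdd 2 (σ i) :=
  Equiv.Perm.viaEmbedding_apply σ (Fin.castAddEmb 2) i

theorem extendPerm_natAdd (σ : Equiv.Perm (Fin 22)) (i : Fin 2) :
    extendPerm σ (Fin.natAdd 22 i) = Fin.natAdd 22 i := by
  refine Equiv.Perm.viaEmbedding_apply_of_notMem σ (Fin.castAddEmb 2) _ ?_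
  rintro ⟨j, hj⟩
  have h := congrArg Fin.val hj
  simp only [Fin.castAddEmb_apply, Fin.val_castAdd, Fin.val_natAdd] at h
  omega

theorem mem_mathieuM22 {σ : Equiv.Perm (Fin 22)} :
    σ ∈ mathieuM22 ↔ ∀ w, w ∘ extendPerm σ ∈ golayCode ↔ w ∈ golayCode :=
  Iff.rfl

/-- A table of the images of 22 points defines an element of `M₂₂` if the permutation of the 24
coordinates which it defines carries the basis words into the Golay code. The entries 22 and 23 that
are appended to the table fix the last two coordinates. -/
theorem exists_smul_maskSet {t : List ℕ} (hlen : t.length = 22) (hnodup : t.Nodup)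
    (hlt : ∀ a ∈ t, a < 22)
    (hcode : ∀ b ∈ golayBasis, reduceMask golayBasis (actMask (t ++ [22, 23]) b) = 0) :
    ∃ g : mathieuM22, ∀ n, maskSet (actMask t n) = g • maskSet n := by
  let f : Fin 22 → Fin 22 := fun i => ⟨t[i], hlt _ (List.getElem_mem _)⟩
  have hf : Function.Injective f := by
    intro i j hij
    have h : t[(i : ℕ)] = t[(j : ℕ)] := congrArg Fin.val hij
    exact Fin.ext (hnodup.getElem_inj_iff.1 h)
  let σ : Equiv.Perm (Fin 22) := Equiv.ofBijective f (Finite.injective_iff_bijective.1 hf)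
  have hσ : ∀ i, (σ i : ℕ) = t[(i : ℕ)] := fun i => rfl
  have hlen' : (t ++ [22, 23]).length = 24 := by simp [hlen]
  have hnodup' : (t ++ [22, 23]).Nodup := by
    rw [List.nodup_append]
    refine ⟨hnodup, by decide, fun a ha b hb => ?_⟩
    have := hlt a ha
    simp only [List.mem_cons, List.not_mem_nil, or_false] at hb
    omega
  have hext : ∀ j : Fin 24, (extendPerm σ j : ℕ) = (t ++ [22, 23])[(j : ℕ)] := by
    intro j
    refine Fin.addCases (m := 22) (n := 2) (fun i => ?_) (fun i => ?_) j
    · rw [extendPerm_castAdd]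
      simp [hσ, hlen]
    · rw [extendPerm_natAdd]
      fin_cases i <;> simp [hlen]
  have hmem : σ ∈ mathieuM22 := by
    refine mem_mathieuM24_of_golayBasis (e := extendPerm σ) fun b hb =>
      ⟨actMask (t ++ [22, 23]) b, ?_, ?_⟩
    · rw [golayCode_eq_maskSpan]
      exact maskWord_mem_of_reduceMask_eq_zero (hcode b hb)
    · funext j
      simp only [Function.comp_apply, maskWord, hext]
      rw [testBit_actMask_getElem hnodup']
  refine ⟨⟨σ, hmem⟩, fun n => ?_⟩
  ext i
  rw [← Finset.inv_smul_mem_iff, mem_maskSet, mem_maskSet]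
  obtain ⟨j, rfl⟩ := σ.surjective i
  have h : (⟨σ, hmem⟩ : mathieuM22)⁻¹ • σ j = j := σ.symm_apply_apply j
  rw [h, hσ, testBit_actMask_getElem hnodup]

/-- Tables of the images of the points `0, …, 21` under the identity and under nine further elements
of `M₂₂`. -/
def generators : List (List ℕ) :=
  [List.range 22,
    [6, 17, 9, 7, 0, 1, 13, 10, 16, 19, 12, 5, 2, 8, 11, 14, 18, 20, 4, 3, 15, 21],
    [12, 21, 15, 6, 13, 17, 14, 8, 5, 2, 4, 11, 16, 19, 7, 20, 9, 3, 10, 1, 0, 18],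
    [13, 21, 16, 3, 1, 14, 19, 7, 18, 11, 20, 5, 4, 15, 9, 17, 6, 0, 8, 2, 10, 12],
    [11, 2, 9, 7, 16, 17, 20, 19, 12, 13, 18, 4, 8, 1, 14, 15, 0, 10, 5, 21, 6, 3],
    [0, 7, 1, 9, 18, 8, 15, 14, 19, 11, 16, 10, 6, 2, 13, 4, 3, 17, 12, 20, 21, 5],
    [1, 16, 11, 3, 10, 21, 7, 12, 19, 17, 0, 5, 2, 9, 8, 14, 18, 15, 20, 13, 4, 6],
    [11, 8, 2, 3, 16, 17, 18, 19, 20, 7, 12, 1, 9, 5, 6, 21, 14, 15, 4, 10, 0, 13],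
    [2, 10, 19, 17, 18, 5, 15, 1, 20, 0, 4, 16, 8, 9, 14, 12, 21, 11, 7, 13, 6, 3],
    [2, 19, 14, 5, 3, 0, 6, 1, 7, 18, 15, 4, 16, 10, 11, 21, 20, 9, 13, 12, 8, 17]]

theorem exists_smul_of_mem_generators :
    ∀ t ∈ generators, ∃ g : mathieuM22, ∀ n, maskSet (actMask t n) = g • maskSet n := by
  have h : ∀ t ∈ generators, t.length = 22 ∧ t.Nodup ∧ (∀ a ∈ t, a < 22) ∧
      ∀ b ∈ golayBasis, reduceMask golayBasis (actMask (t ++ [22, 23]) b) = 0 := by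
    decide +kernel
  intro t ht
  obtain ⟨h1, h2, h3, h4⟩ := h t ht
  exact exists_smul_maskSet h1 h2 h3 h4

/-- Apply to the bit mask `n` the generators that are named by the last `k` decimal digits of `w`,
starting with the last one. -/
def applyWord : ℕ → ℕ → ℕ → ℕ
  | 0, _, n => n
  | k + 1, w, n => if w = 0 then n else
      strict (actMask (generators.getD (w % 10) (List.range 22)) n)
        fun m => strict (w / 10) fun v => applyWord k v m

theorem imagesOf_applyWord (k w n : ℕ) :
    imagesOf mathieuM22 (maskSet (applyWord k w n)) = imagesOf mathieuM22 (maskSet n) := by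
  induction k generalizing w n with
  | zero => rfl
  | succ k ih =>
    rw [applyWord]
    split_ifs with h
    · rfl
    · have hmem : generators.getD (w % 10) (List.range 22) ∈ generators := by
        have : w % 10 < generators.length := Nat.mod_lt _ (by decide)
        rw [List.getD_eq_getElem _ _ this]
        exact List.getElem_mem _
      obtain ⟨g, hg⟩ := exists_smul_of_mem_generators _ hmem
      rw [strict_eq, strict_eq, ih, hg, imagesOf_smul]

/-! ### Heptads -/

/-- The word of length 24 that is the characteristic function of `h` on the first 22 points, and
`1`, `0` on the last two. -/
def heptadWord (h : Finset (Fin 22)) : Fin 24 → ZMod 2 :=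
  Fin.append (m := 22) (n := 2) (fun i => if i ∈ h then 1 else 0) ![1, 0]

/-- The 7-sets that become octads of the Golay code together with the last but one of the
24 points. -/
noncomputable def heptads : Finset (Finset (Fin 22)) := by
  classical exact Finset.univ.filter fun h => h.card = 7 ∧ heptadWord h ∈ golayCode

theorem mem_heptads {h : Finset (Fin 22)} :
    h ∈ heptads ↔ h.card = 7 ∧ heptadWord h ∈ golayCode := by
  simp [heptads]

theorem heptadWord_smul (g : mathieuM22) (h : Finset (Fin 22)) :
    heptadWord (g • h) ∘ extendPerm g = heptadWord h := by
  funext j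
  refine Fin.addCases (m := 22) (n := 2) (fun i => ?_) (fun i => ?_) j
  · have hi : (g : Equiv.Perm (Fin 22)) i ∈ g • h ↔ i ∈ h :=
      Finset.smul_mem_smul_finset_iff (s := h) (b := i) g
    rw [Function.comp_apply, extendPerm_castAdd, heptadWord, heptadWord, Fin.append_left,
      Fin.append_left]
    simp only [hi]
  · rw [Function.comp_apply, extendPerm_natAdd, heptadWord, heptadWord, Fin.append_right,
      Fin.append_right]

theorem smul_mem_heptads (g : mathieuM22) {h : Finset (Fin 22)} :
    g • h ∈ heptads ↔ h ∈ heptads := by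
  rw [mem_heptads, mem_heptads, Finset.card_smul_finset, ← heptadWord_smul g h,
    mem_mathieuM22.1 g.2]

/-- The generating function `∑ X ^ #(h ∩ Δ)`, over all heptads `h`, at `X = 5`. With
this choice of `X` the number still separates the orbits on subsets of each size up to eleven. -/
noncomputable def heptadSum (Δ : Finset (Fin 22)) : ℕ :=
  ∑ h ∈ heptads, 5 ^ (h ∩ Δ).card

theorem heptadSum_smul (g : mathieuM22) (Δ : Finset (Fin 22)) :
    heptadSum (g • Δ) = heptadSum Δ := by
  symm
  refine Finset.sum_bij (fun h _ => g • h) (fun h hh => (smul_mem_heptads g).2 hh)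
    (fun h _ h' _ => fun e => MulAction.injective g e)
    (fun h hh => ⟨g⁻¹ • h, (smul_mem_heptads _).2 hh, smul_inv_smul g h⟩) fun h _ => ?_
  rw [← Finset.smul_finset_inter, Finset.card_smul_finset]

theorem heptadSum_eq_of_imagesOf_eq {Δ Γ : Finset (Fin 22)}
    (h : imagesOf mathieuM22 Δ = imagesOf mathieuM22 Γ) : heptadSum Δ = heptadSum Γ := by
  obtain ⟨g, rfl⟩ := mem_imagesOf.1 (imagesOf_eq_iff.1 h)
  exact heptadSum_smul g Γ

/-- Bit masks of the octads of the Golay code that contain the last but one of the 24 points and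
not the last one. -/
def heptadMasks : List ℕ :=
  [7880904, 7940097, 7864854, 7491587, 7397920, 7349570, 7505988, 7538304, 7373201, 7341101,
   7409776, 7346952, 6533376, 6305297, 6430945, 6365772, 6302004, 6335624, 6422926, 6456370,
   6357795, 6293595, 6364166, 6329026, 6439760, 6506536, 6407233, 6310533, 6313376, 6344732,
   6381714, 6828074, 6980105, 6914212, 6882584, 6819424, 6953104, 6820165, 6867202, 6972420,
   4411588, 4382208, 4215401, 4282641, 4342937, 4374821, 4214092, 4245744, 4309896, 4277812,
   4382794, 4221987, 4223750, 4402256, 4335400, 4366996, 4238145, 4300857, 4269445, 4339725,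
   4207064, 4240484, 4274848, 4395546, 4331874, 4198583, 4232459, 4425859, 4326983, 4198290,
   4229678, 4292950, 4261098, 4740178, 4866722, 4800527, 4745752, 4809056, 4780161, 4858131,
   4729030, 4826626, 4920353, 4724364, 4756272, 4823112, 4918020, 4849788, 4883904, 4721065,
   4754453, 4784849, 5808396, 5776560, 5911104, 5837186, 5901322, 5800035, 5789732, 6012944,
   5785345, 5447718, 5251723, 5290002, 5410984, 5379348, 5250241, 5345797, 5439817, 5376561,
   5277272, 5243876, 5310620, 5344544, 5293190, 5259578, 5327426, 5400960, 5267541, 5338120,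
   8164352, 7684356, 7604386, 7741464, 6623369, 6689316, 6654480, 6554836, 6586728, 6688001,
   6594567, 6584384, 6571530, 7274562, 7086976, 7094321, 4481196, 4515088, 4678145, 4473283,
   4605974, 4575266, 4457245, 4490913, 4524133, 4686860, 4653488, 4590280, 4463672, 4495748,
   4527936, 4624465, 4600962, 4465266, 4532490, 5030468, 5065856, 5132552, 4982054, 5013658,
   4987395, 5058580, 4990025, 5154848, 6031696, 6095400, 6160517, 5571603, 5669634, 5509198,
   5517601, 5516804, 5611712, 5556233, 5653600, 5526160]

theorem filter_xorClosure_golayBasis :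
    ((xorClosure golayBasis).filter fun n => strict n fun n =>
      n / 2 ^ 22 == 1 && popcount 22 n == 7) = heptadMasks := by
  decide +kernel

theorem nodup_heptadMasks : heptadMasks.Nodup := by
  decide +kernel

theorem mem_heptadMasks {n : ℕ} :
    n ∈ heptadMasks ↔ n ∈ xorClosure golayBasis ∧ n / 2 ^ 22 = 1 ∧ popcount 22 n = 7 := by
  rw [← filter_xorClosure_golayBasis, List.mem_filter]
  simp only [strict_eq, Bool.and_eq_true, beq_iff_eq]

theorem testBit_add_of_mem_heptadMasks {n : ℕ} (hn : n ∈ heptadMasks) (i : ℕ) :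
    n.testBit (22 + i) = decide (i = 0) := by
  rw [add_comm, ← Nat.testBit_div_two_pow, (mem_heptadMasks.1 hn).2.1, Bool.eq_iff_iff,
    Nat.testBit_one_eq_true_iff_self_eq_zero, decide_eq_true_iff]

theorem maskWord_eq_heptadWord {n : ℕ} (h0 : n.testBit 22 = true) (h1 : n.testBit 23 = false) :
    maskWord n = heptadWord (maskSet n) := by
  funext j
  refine Fin.addCases (m := 22) (n := 2) (fun i => ?_) (fun i => ?_) j
  · rw [heptadWord, Fin.append_left]
    simp [maskWord]
  · rw [heptadWord, Fin.append_right]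
    fin_cases i <;> simp [maskWord, h0, h1]

theorem injOn_maskSet_heptadMasks {m n : ℕ} (hm : m ∈ heptadMasks) (hn : n ∈ heptadMasks)
    (h : maskSet m = maskSet n) : m = n := by
  refine Nat.eq_of_testBit_eq fun i => ?_
  rcases lt_or_ge i 22 with hi | hi
  · have := Finset.ext_iff.1 h ⟨i, hi⟩
    rw [mem_maskSet, mem_maskSet] at this
    exact Bool.eq_iff_iff.2 this
  · obtain ⟨j, rfl⟩ := Nat.exists_eq_add_of_le hi
    rw [testBit_add_of_mem_heptadMasks hm, testBit_add_of_mem_heptadMasks hn]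

theorem xorClosure_golayBasis_lt : ∀ n ∈ xorClosure golayBasis, n < 2 ^ 24 := by
  have h : ∀ B : List ℕ, (∀ b ∈ B, b < 2 ^ 24) → ∀ n ∈ xorClosure B, n < 2 ^ 24 := by
    intro B
    induction B with
    | nil => simp [xorClosure]
    | cons b B ih =>
      intro hB n hn
      have ih' := ih fun c hc => hB c (by simp [hc])
      simp only [xorClosure, List.mem_append, List.mem_map] at hn
      rcases hn with hn | ⟨m, hm, rfl⟩
      · exact ih' n hn
      · exact Nat.xor_lt_two_pow (hB b (by simp)) (ih' m hm)
  exact h _ (by decide)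

theorem heptads_eq : heptads = (heptadMasks.map maskSet).toFinset := by
  ext h
  rw [mem_heptads, golayCode_eq_maskSpan, mem_maskSpan_iff, List.mem_toFinset, List.mem_map]
  constructor
  · rintro ⟨hcard, n, hn, hw⟩
    have h22 : n.testBit 22 = true :=
      (maskWord_eq_one_iff (j := Fin.natAdd 22 (0 : Fin 2))).1 <| by
        rw [hw]
        exact Fin.append_right _ _ 0
    have h23 : n.testBit 23 = false := by
      refine Bool.eq_false_iff.2 fun h1 => ?_
      have h2 : maskWord n (Fin.natAdd 22 (1 : Fin 2)) = 1 := maskWord_eq_one_iff.2 h1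
      rw [hw, heptadWord, Fin.append_right] at h2
      exact absurd h2 (by decide)
    have hset : maskSet n = h := by
      ext i
      have := congrFun hw (Fin.castAdd 2 i)
      rw [heptadWord, Fin.append_left] at this
      by_cases hi : i ∈ h <;> simp_all [maskWord]
    refine ⟨n, mem_heptadMasks.2 ⟨hn, ?_, ?_⟩, hset⟩
    · have hlt : n / 2 ^ 22 < 4 := by
        have := xorClosure_golayBasis_lt n hn
        omega
      have h0 : (n / 2 ^ 22).testBit 0 = true := by rw [Nat.testBit_div_two_pow]; exact h22
      have h1 : (n / 2 ^ 22).testBit 1 = false := by rw [Nat.testBit_div_two_pow]; exact h23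
      have h : ∀ q < 4, Nat.testBit q 0 = true → Nat.testBit q 1 = false → q = 1 := by decide
      exact h _ hlt h0 h1
    · rw [← card_maskSet, hset, hcard]
  · rintro ⟨n, hn, rfl⟩
    have h22 := testBit_add_of_mem_heptadMasks hn 0
    have h23 := testBit_add_of_mem_heptadMasks hn 1
    obtain ⟨h1, h2, h3⟩ := mem_heptadMasks.1 hn
    exact ⟨(card_maskSet n).trans h3, n, h1, maskWord_eq_heptadWord h22 h23⟩

/-- The value of `heptadSum` on the set with bit mask `m`. -/
def heptadMaskSum (m : ℕ) : ℕ :=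
  (heptadMasks.map fun h => 5 ^ strict (h &&& m) (popcount 22)).sum

theorem heptadSum_maskSet (m : ℕ) : heptadSum (maskSet m) = heptadMaskSum m := by
  have hnodup : (heptadMasks.map maskSet).Nodup :=
    nodup_heptadMasks.map_on fun _ hm _ hn h => injOn_maskSet_heptadMasks hm hn h
  rw [heptadSum, heptads_eq, List.sum_toFinset _ hnodup, List.map_map, heptadMaskSum]
  congr 1
  refine List.map_congr_left fun h _ => ?_
  rw [Function.comp_apply, maskSet_inter, card_maskSet, strict_eq]

/-! ### Certificates for the orbits -/

/-- An orbit of `M₂₂` on the `k`-subsets: the bit mask `rep` of a representative, the number `size`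
of sets in the orbit, and the number `value` that `heptadSum` takes on it. The bit masks of the
sets that arise from the representative by adding a point, in the order of the points added, are
carried by `words` to `targets`, which are representatives of orbits on the `(k + 1)`-subsets. -/
structure OrbitRow where
  rep : ℕ
  size : ℕ
  value : ℕ
  words : List ℕ
  targets : List ℕ

/-- The bit masks of the sets with one more point than the set with bit mask `m`, in the order of
the points added. -/
def extensionMasks (m : ℕ) : List ℕ :=
  ((List.range 22).filter fun j => !m.testBit j).map fun j => m ||| 1 <<< j

/-- The number of decimal digits that are read from each word. -/
def wordLength : ℕ := 7

/-- The finite verification that leads from the orbits on `k`-subsets to those on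
`(k + 1)`-subsets. -/
def StepValid (k : ℕ) (L L' : List OrbitRow) : Prop :=
  (∀ r ∈ L, r.words.length = (extensionMasks r.rep).length ∧
    List.zipWith (applyWord wordLength) r.words (extensionMasks r.rep) = r.targets ∧
    ∀ t ∈ r.targets, t ∈ L'.map OrbitRow.rep) ∧
  (∀ r ∈ L', popcount 22 r.rep = k + 1 ∧ heptadMaskSum r.rep = r.value) ∧
  (L'.map OrbitRow.value).Nodup ∧
  ∀ r' ∈ L', (L.map fun r => r.size * r.targets.count r'.rep).sum = (k + 1) * r'.size

instance (k : ℕ) (L L' : List OrbitRow) : Decidable (StepValid k L L') := by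
  unfold StepValid
  infer_instance

/-- The rows of `L` describe all orbits of `M₂₂` on the `k`-subsets, each of them once. -/
structure DescribesOrbits (k : ℕ) (L : List OrbitRow) : Prop where
  orbitPartition_eq : (orbitPartition mathieuM22 (Fin 22) k).val =
    (L.map fun r => maskSet r.rep).map (imagesOf mathieuM22)
  card_eq : ∀ r ∈ L, (imagesOf mathieuM22 (maskSet r.rep)).card = r.size

theorem DescribesOrbits.orbitSizes_eq {k : ℕ} {L : List OrbitRow} (h : DescribesOrbits k L) :
    orbitSizes mathieuM22 (Fin 22) k = (L.map OrbitRow.size : List ℕ) := by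
  rw [_root_.orbitSizes_eq h.orbitPartition_eq, List.map_map]
  congr 1
  exact List.map_congr_left fun r hr => h.card_eq r hr

theorem mem_extensionMasks {m : ℕ} {x : Fin 22} (hx : x ∉ maskSet m) :
    m ||| 1 <<< (x : ℕ) ∈ extensionMasks m := by
  refine List.mem_map.2 ⟨x, List.mem_filter.2 ⟨List.mem_range.2 x.2, ?_⟩, rfl⟩
  simpa using hx

theorem extensionCount_maskSet (m : ℕ) (Γ : Finset (Fin 22))
    [DecidablePred fun e => maskSet e ∈ imagesOf mathieuM22 Γ] :
    extensionCount mathieuM22 (maskSet m) Γ =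
      (extensionMasks m).countP fun e => maskSet e ∈ imagesOf mathieuM22 Γ := by
  rw [extensionMasks, List.countP_map, List.countP_filter, ← List.map_coe_finRange_eq_range,
    List.countP_map, extensionCount, Fin.univ_def]
  simp only [Finset.card, Finset.filter, Multiset.filter_coe, Multiset.coe_card,
    List.countP_eq_length_filter]
  congr 2
  funext x
  rw [Bool.eq_iff_iff]
  simp [maskSet_insert, and_comm]

/-- Since `heptadSum` separates the representatives in `L'`, the orbit of an extension is that of
the target to which its word carries it. -/
theorem countP_eq_count {L' : List OrbitRow} {r' : OrbitRow} (hr' : r' ∈ L')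
    (hnodup : (L'.map OrbitRow.value).Nodup)
    (hvalue : ∀ r ∈ L', heptadSum (maskSet r.rep) = r.value)
    [DecidablePred fun e => maskSet e ∈ imagesOf mathieuM22 (maskSet r'.rep)]
    (ws es : List ℕ) (hlen : ws.length = es.length)
    (hmem : ∀ t ∈ List.zipWith (applyWord wordLength) ws es, t ∈ L'.map OrbitRow.rep) :
    es.countP (fun e => maskSet e ∈ imagesOf mathieuM22 (maskSet r'.rep)) =
      (List.zipWith (applyWord wordLength) ws es).count r'.rep := by
  induction ws generalizing es with
  | nil =>
    obtain rfl : es = [] := List.length_eq_zero_iff.1 hlen.symm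
    rfl
  | cons w ws ih =>
    obtain ⟨e, es, rfl⟩ := List.exists_cons_of_length_eq_add_one hlen.symm
    rw [List.zipWith_cons_cons] at hmem ⊢
    rw [List.countP_cons, List.count_cons, ih es (by simpa using hlen)
      fun t ht => hmem t (List.mem_cons_of_mem _ ht)]
    congr 1
    have hiff : maskSet e ∈ imagesOf mathieuM22 (maskSet r'.rep) ↔
        applyWord wordLength w e = r'.rep := by
      rw [← imagesOf_eq_iff, ← imagesOf_applyWord wordLength w e]
      constructor
      · intro h
        obtain ⟨r, hr, hrep⟩ := List.mem_map.1 (hmem _ List.mem_cons_self)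
        rw [← hrep] at h ⊢
        have hv : r.value = r'.value := by
          rw [← hvalue r hr, ← hvalue r' hr', heptadSum_eq_of_imagesOf_eq h]
        rw [List.inj_on_of_nodup_map hnodup hr hr' hv]
      · exact fun h => by rw [h]
    simp [hiff]

theorem DescribesOrbits.succ {k : ℕ} {L L' : List OrbitRow} (h : DescribesOrbits k L)
    (hstep : StepValid k L L') : DescribesOrbits (k + 1) L' := by
  classical
  obtain ⟨hL, hL', hnodup, hsize⟩ := hstep
  have hvalue : ∀ r ∈ L', heptadSum (maskSet r.rep) = r.value := fun r hr => by
    rw [heptadSum_maskSet, (hL' r hr).2]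
  have hcard : ∀ r ∈ L', (maskSet r.rep).card = k + 1 := fun r hr => by
    rw [card_maskSet, (hL' r hr).1]
  refine ⟨orbitPartition_succ h.orbitPartition_eq ?_ ?_ ?_, fun r' hr' => ?_⟩
  · intro Γ hΓ
    obtain ⟨r, hr, rfl⟩ := List.mem_map.1 hΓ
    exact hcard r hr
  · have hpair : L'.Pairwise fun r s => r.value ≠ s.value := List.pairwise_map.1 hnodup
    refine List.pairwise_map.2 (List.pairwise_map.2 (hpair.imp_of_mem fun hr hs hne heq => hne ?_))
    rw [← hvalue _ hr, ← hvalue _ hs, heptadSum_eq_of_imagesOf_eq heq]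
  · intro Δ hΔ x hx
    obtain ⟨r, hr, rfl⟩ := List.mem_map.1 hΔ
    obtain ⟨hlen, hzip, hmem⟩ := hL r hr
    obtain ⟨i, hi, hie⟩ := List.mem_iff_getElem.1 (mem_extensionMasks hx)
    have hi' : i < (List.zipWith (applyWord wordLength) r.words (extensionMasks r.rep)).length := by
      rw [List.length_zipWith, hlen, min_self]
      exact hi
    rw [← hzip] at hmem
    obtain ⟨r', hr', hrep⟩ := List.mem_map.1 (hmem _ (List.getElem_mem hi'))
    refine ⟨maskSet r'.rep, List.mem_map_of_mem hr', ?_⟩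
    rw [← imagesOf_eq_iff, maskSet_insert, ← hie, hrep, List.getElem_zipWith, imagesOf_applyWord]
  · have hsum := card_mul_card_imagesOf_eq_sum (hcard r' hr') h.orbitPartition_eq
    rw [List.map_map] at hsum
    refine Nat.eq_of_mul_eq_mul_left k.succ_pos (hsum.trans (Eq.trans ?_ (hsize r' hr')))
    congr 1
    refine List.map_congr_left fun r hr => ?_
    obtain ⟨hlen, hzip, hmem⟩ := hL r hr
    rw [Function.comp_apply, h.card_eq r hr, extensionCount_maskSet,
      countP_eq_count hr' hnodup hvalue r.words _ hlen (by rwa [hzip]), hzip]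

/-! ### The orbits on sets of at most eleven points -/

/-- The orbit of the empty set. -/
def level0 : List OrbitRow :=
  [
    ⟨0, 1, 176,
      [0, 31, 43, 38, 1, 9, 24, 61, 27, 8, 6, 14, 13, 69, 83, 15, 4, 3, 11, 25, 2, 39],
      [1, 1, 1, 1, 1, 1, 1, 1, 1, 1, 1, 1, 1, 1, 1, 1, 1, 1, 1, 1, 1, 1]⟩]

/-- The orbit on the points. -/
def level1 : List OrbitRow :=
  [
    ⟨1, 22, 400,
      [0, 5, 197, 741, 59, 74, 231, 77, 58, 6, 65, 288, 55, 555, 397, 316, 553, 344, 394, 289,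
       194],
      [3, 3, 3, 3, 3, 3, 3, 3, 3, 3, 3, 3, 3, 3, 3, 3, 3, 3, 3, 3, 3]⟩]

/-- The orbit on 2-subsets. -/
def level2 : List OrbitRow :=
  [
    ⟨3, 231, 880,
      [0, 85, 3879, 5712, 74, 2725, 4152, 296, 14514, 132, 4579, 546, 458, 5831, 1975, 12564,
       4631, 46, 1571, 95],
      [7, 7, 7, 7, 7, 7, 7, 7, 7, 7, 7, 7, 7, 7, 7, 7, 7, 7, 7, 7]⟩]

/-- The orbit on 3-subsets. -/
def level3 : List OrbitRow :=
  [
    ⟨7, 1540, 1872,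
      [0, 43, 6988, 3123, 4971, 0, 11519, 1513, 5814, 16662, 15552, 2992, 5831, 4136, 6656,
       8258, 4346, 777, 27255],
      [15, 15, 15, 15, 15, 263, 15, 15, 263, 15, 15, 15, 15, 15, 15, 15, 15, 263, 15]⟩]

/-- The orbits on 4-subsets, by increasing size. -/
def level4 : List OrbitRow :=
  [
    ⟨263, 1155, 3632,
      [25621, 58755, 51987, 3123, 4781, 2266, 1513, 0, 48925, 29328, 17599, 5831, 17749, 2644,
       2174, 21153, 173, 39347],
      [31, 31, 31, 31, 31, 31, 31, 2311, 31, 31, 31, 31, 31, 31, 31, 31, 2311, 31]⟩,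
    ⟨15, 6160, 3888,
      [0, 41168, 34942, 48176, 25621, 0, 24626, 7544, 4831, 8222, 0, 6492, 946, 332, 3157, 2672,
       55599, 287],
      [31, 31, 31, 31, 31, 527, 31, 31, 527, 31, 16399, 31, 16399, 31, 31, 16399, 31, 527]⟩]

/-- The orbits on 5-subsets, by increasing size. -/
def level5 : List OrbitRow :=
  [
    ⟨2311, 462, 6416,
      [7544, 31644, 35552, 524, 4781, 2266, 1513, 41334, 223, 14534, 5428, 15166, 2644, 2174,
       4727, 0, 5746],
      [1055, 1055, 1055, 1055, 1055, 1055, 1055, 1055, 1055, 1055, 1055, 1055, 1055, 1055, 1055,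
       1050887, 1055]⟩,
    ⟨527, 3696, 7696,
      [389693, 241646, 242145, 164469, 63782, 237797, 68274, 0, 227811, 131884, 311239, 53296,
       59369, 3157, 65139, 65446, 2965],
      [63, 63, 63, 63, 63, 63, 63, 4623, 63, 63, 63, 63, 63, 63, 63, 63, 4623]⟩,
    ⟨16399, 3696, 8720,
      [42148, 12865, 47927, 256517, 2958, 131884, 13112, 7544, 16298, 6989, 66723, 0, 72951,
       95961, 1878, 85538, 83227],
      [63, 63, 63, 63, 63, 63, 63, 63, 63, 63, 63, 81935, 63, 63, 81935, 63, 63]⟩,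
    ⟨31, 18480, 7440,
      [0, 254634, 86893, 71497, 389693, 0, 39431, 21913, 8222, 42148, 0, 42431, 9973, 6383,
       33915, 13858, 121822],
      [63, 63, 63, 63, 63, 1055, 63, 63, 1055, 63, 32799, 63, 32799, 63, 63, 32799, 63]⟩]

/-- The orbits on 6-subsets, by increasing size. -/
def level6 : List OrbitRow :=
  [
    ⟨1050887, 77, 10480,
      [85, 4112, 396, 524, 426, 2266, 472, 745, 223, 2542, 5428, 3241, 968, 2174, 696, 2237],
      [9247, 9247, 9247, 9247, 9247, 9247, 9247, 9247, 9247, 9247, 9247, 9247, 9247, 9247, 9247,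
       9247]⟩,
    ⟨4623, 1232, 14320,
      [37711, 8351, 14784, 36573, 7132, 42268, 22225, 15552, 16298, 113589, 2234, 59715, 86162,
       14316, 48398, 0],
      [2111, 2111, 2111, 2111, 2111, 2111, 2111, 2111, 2111, 2111, 2111, 2111, 2111, 2111, 2111,
       2101775]⟩,
    ⟨81935, 1232, 24560,
      [38342, 12865, 44611, 26687, 47365, 114128, 9188, 2462, 2567, 6989, 92227, 332, 15658, 0,
       78191, 2575],
      [191, 191, 191, 191, 191, 191, 191, 191, 191, 191, 191, 191, 191, 606223, 191, 191]⟩,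
    ⟨1055, 7392, 13040,
      [0, 138515, 253563, 42326, 367754, 36249, 198133, 0, 44641, 24626, 165631, 68394, 218456,
       22982, 56647, 175849],
      [1087, 1087, 1087, 1087, 1087, 1087, 1087, 9247, 1087, 1087, 1087, 1087, 1087, 1087, 1087,
       1087]⟩,
    ⟨32799, 9240, 13552,
      [663251, 92499, 18248, 22867, 465884, 24626, 147934, 114678, 37213, 128352, 59957, 0,
       72398, 33915, 4834, 4875],
      [127, 1087, 1087, 127, 1087, 1087, 127, 127, 1087, 1087, 127, 163871, 127, 127, 163871,
       127]⟩,
    ⟨63, 55440, 14832,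
      [0, 0, 148949, 174869, 0, 0, 2876, 59711, 9848, 663251, 39974, 85357, 9848, 21453, 9848,
       121822],
      [127, 191, 127, 127, 1087, 2111, 191, 1087, 2111, 127, 127, 1087, 1087, 127, 127, 127]⟩]

/-- The orbits on 7-subsets, by increasing size. -/
def level7 : List OrbitRow :=
  [
    ⟨606223, 176, 91600,
      [975, 46, 3475, 7162, 967, 1318, 931, 2462, 2567, 3467, 13537, 332, 1988, 2393, 2575],
      [4287, 4287, 4287, 4287, 4287, 4287, 4287, 4287, 4287, 4287, 4287, 4287, 4287, 4287, 4287]⟩,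
    ⟨2101775, 176, 25040,
      [849, 3413, 364, 15138, 367, 3326, 1122, 738, 2564, 1455, 2234, 2322, 1879, 2672, 2237],
      [18495, 18495, 18495, 18495, 18495, 18495, 18495, 18495, 18495, 18495, 18495, 18495,
       18495, 18495, 18495]⟩,
    ⟨9247, 1232, 21200,
      [0, 17555, 18158, 14492, 15285, 1269, 15552, 8153, 11486, 3383, 3268, 6383, 9814, 4949,
       44569],
      [9279, 9279, 9279, 9279, 9279, 9279, 9279, 9279, 9279, 9279, 9279, 9279, 9279, 9279, 9279]⟩,
    ⟨163871, 2640, 23248,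
      [357919, 26366, 38618, 22867, 4192, 154661, 17294, 56326, 64839, 41135, 59957, 34973,
       33915, 0, 4875],
      [383, 383, 383, 383, 383, 383, 383, 383, 383, 383, 383, 383, 383, 1212447, 383]⟩,
    ⟨191, 18480, 34256,
      [0, 6357, 86893, 13653, 26292, 0, 22221, 12865, 273283, 158338, 83912, 65268, 21453,
       112998, 39455],
      [255, 2175, 255, 255, 2175, 4287, 255, 2175, 255, 2175, 255, 255, 2175, 2175, 255]⟩,
    ⟨2111, 18480, 27088,
      [0, 26292, 397826, 19943, 18789, 183671, 16176, 0, 124824, 39431, 1852, 118784, 49629,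
       9848, 67461],
      [2175, 2175, 16511, 2175, 16511, 2175, 16511, 18495, 2175, 16511, 16511, 16511, 16511,
       16511, 2175]⟩,
    ⟨1087, 55440, 25296,
      [0, 13653, 148949, 151665, 18789, 17492, 0, 224376, 25548, 39974, 85357, 318469, 21453,
       61329, 165731],
      [1151, 255, 1151, 383, 16511, 255, 9279, 16511, 16511, 16511, 1151, 1151, 383, 255, 255]⟩,
    ⟨127, 73920, 26832,
      [0, 0, 0, 0, 0, 5778, 48879, 0, 93747, 39974, 335875, 152541, 35478, 63328, 121822],
      [255, 383, 639, 1151, 2175, 2175, 383, 16511, 16511, 639, 255, 16511, 2175, 639, 255]⟩]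

/-- The orbits on 8-subsets, by increasing size. -/
def level8 : List OrbitRow :=
  [
    ⟨1212447, 330, 37808,
      [2195, 19897, 11146, 2825, 1893, 15758, 17294, 3382, 7357, 777, 3883, 6336, 15898, 1967],
      [8575, 8575, 8575, 8575, 8575, 8575, 8575, 8575, 8575, 8575, 8575, 8575, 8575, 8575]⟩,
    ⟨4287, 2640, 106160,
      [0, 18764, 469, 12972, 7226, 22221, 19215, 21716, 39974, 2876, 1413, 56788, 9848, 15112],
      [4351, 4351, 4351, 4351, 4351, 4351, 4351, 4351, 4351, 4351, 4351, 4351, 4351, 4351]⟩,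
    ⟨18495, 2640, 46768,
      [0, 12865, 21439, 19943, 18789, 43745, 16176, 35377, 39431, 1852, 42751, 49629, 9848, 7544],
      [18559, 18559, 18559, 18559, 18559, 18559, 18559, 18559, 18559, 18559, 18559, 18559,
       18559, 18559]⟩,
    ⟨9279, 9240, 40880,
      [188, 13653, 78717, 14718, 39878, 17492, 1268, 5218, 175681, 14486, 86814, 21453, 16249,
       18968],
      [1407, 33023, 1407, 1407, 33023, 33023, 33023, 33023, 33023, 1407, 1407, 1407, 33023,
       33023]⟩,
    ⟨639, 27720, 47024,
      [134259, 517787, 151665, 154746, 5778, 216144, 255745, 279975, 0, 639748, 123819, 132813,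
       5884, 266252],
      [511, 511, 511, 2303, 2303, 511, 511, 511, 66175, 2303, 2303, 511, 66175, 511]⟩,
    ⟨383, 36960, 44464,
      [0, 517787, 0, 1429629, 678553, 0, 913141, 795823, 42241, 388767, 515852, 7539, 516924,
       144881],
      [511, 511, 1407, 511, 511, 8575, 511, 511, 511, 511, 511, 511, 511, 511]⟩,
    ⟨1151, 36960, 44208,
      [0, 0, 151665, 97917, 53332, 188, 0, 25548, 123793, 85357, 152541, 382745, 37146, 227979],
      [1279, 1407, 511, 511, 511, 1407, 17535, 17535, 511, 1279, 17535, 511, 511, 1279]⟩,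
    ⟨2175, 55440, 53424,
      [0, 1429629, 154746, 97917, 313825, 48879, 0, 327126, 5125, 211193, 57281, 77742, 658481,
       18745],
      [2303, 511, 2303, 511, 2303, 511, 18559, 2303, 2303, 2303, 2303, 2303, 511, 4351]⟩,
    ⟨255, 73920, 51888,
      [0, 134259, 0, 0, 0, 152541, 63869, 0, 63377, 1848, 65268, 63869, 29589, 39455],
      [511, 511, 1279, 2303, 4351, 511, 511, 33023, 2303, 1279, 511, 2303, 511, 1279]⟩,
    ⟨16511, 73920, 45744,
      [63869, 913141, 255745, 0, 0, 466988, 415154, 65138, 1127487, 335875, 25333, 186398,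
       11451, 87462],
      [511, 511, 511, 17535, 18559, 2303, 511, 17535, 511, 511, 17535, 2303, 2303, 33023]⟩]

/-- The orbits on 9-subsets, by increasing size. -/
def level9 : List OrbitRow :=
  [
    ⟨8575, 4620, 71824,
      [0, 27719, 0, 17555, 32549, 142591, 17894, 42241, 162792, 16391, 7539, 77728, 113516],
      [8703, 8703, 9599, 8703, 8703, 8703, 8703, 8703, 8703, 8703, 8703, 8703, 8703]⟩,
    ⟨66175, 6160, 78992,
      [89928, 43195, 8186, 5125, 5778, 176919, 217121, 279975, 273561, 123819, 35478, 0, 533853],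
      [2559, 2559, 2559, 2559, 2559, 2559, 2559, 2559, 2559, 2559, 2559, 1114751, 2559]⟩,
    ⟨1407, 18480, 70800,
      [0, 356152, 97917, 53332, 0, 134379, 12614, 42241, 138515, 22933, 38968, 67534, 273254],
      [1535, 1535, 1535, 1535, 9599, 1535, 1535, 1535, 1535, 1535, 1535, 1535, 1535]⟩,
    ⟨4351, 18480, 133520,
      [0, 59238, 53332, 27958, 32549, 63869, 0, 178961, 8711, 65268, 16746, 29589, 13742],
      [4607, 4607, 4607, 4607, 4607, 4607, 37119, 4607, 4607, 4607, 4607, 4607, 4607]⟩,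
    ⟨18559, 18480, 83344,
      [63869, 299591, 25719, 97917, 18471, 48879, 11841, 216191, 335875, 192432, 6386, 277895,
       11362],
      [66047, 66047, 66047, 66047, 66047, 66047, 66047, 66047, 66047, 66047, 66047, 66047, 37119]⟩,
    ⟨33023, 24640, 78480,
      [25816, 252662, 22414, 0, 0, 58797, 123711, 2314, 83912, 65268, 3747, 29589, 354331],
      [1535, 1535, 1535, 35071, 37119, 1535, 1535, 35071, 1535, 1535, 35071, 1535, 1535]⟩,
    ⟨1279, 36960, 86416,
      [0, 351346, 97917, 53332, 85484, 1129687, 22414, 123793, 0, 59413, 382745, 37146, 3879],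
      [1535, 1023, 1023, 4607, 1535, 1023, 1535, 4607, 132351, 1023, 1023, 1023, 132351]⟩,
    ⟨17535, 36960, 75152,
      [1129687, 134379, 255745, 97917, 474245, 322847, 0, 696245, 28517, 51742, 248187, 37146,
       486145],
      [1023, 1535, 1023, 66047, 1023, 1535, 50303, 1023, 1023, 50303, 1023, 66047, 1535]⟩,
    ⟨2303, 110880, 89232,
      [0, 134259, 97917, 27958, 888675, 63869, 0, 0, 535389, 57281, 25586, 29589, 331423],
      [2559, 66047, 1023, 4607, 1023, 66047, 35071, 67839, 1023, 2559, 67839, 1023, 4607]⟩,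
    ⟨511, 221760, 81552,
      [0, 0, 0, 0, 0, 913141, 25816, 0, 399118, 65268, 296546, 651618, 528757],
      [1023, 1535, 2559, 4607, 8703, 1023, 1535, 66047, 1023, 2559, 1023, 1023, 1023]⟩]

/-- The orbits on 10-subsets, by increasing size. -/
def level10 : List OrbitRow :=
  [
    ⟨1114751, 616, 127600,
      [17228, 25835, 8186, 3139, 816, 9356, 4115, 36346, 8714, 17385, 4646, 3878],
      [264703, 264703, 264703, 264703, 264703, 264703, 264703, 264703, 264703, 264703, 264703,
       264703]⟩,
    ⟨9599, 2310, 112240,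
      [0, 27719, 17555, 31659, 69562, 2663, 188, 121529, 16391, 1814, 33185, 3434],
      [9727, 9727, 9727, 9727, 9727, 9727, 9727, 9727, 9727, 9727, 9727, 9727]⟩,
    ⟨37119, 6160, 174960,
      [25816, 252662, 74644, 27958, 58797, 299186, 76665, 8711, 65268, 16746, 29589, 741],
      [5631, 5631, 5631, 5631, 5631, 5631, 5631, 5631, 5631, 5631, 5631, 5631]⟩,
    ⟨50303, 7392, 120176,
      [273283, 45841, 181577, 29232, 132264, 66376, 56349, 28517, 0, 192593, 94392, 25288],
      [33791, 33791, 33791, 132095, 132095, 33791, 132095, 132095, 312447, 33791, 132095, 33791]⟩,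
    ⟨132351, 7392, 146800,
      [8688, 63265, 66924, 32768, 5728, 28517, 23584, 62468, 59413, 239964, 3756, 0],
      [525311, 5119, 525311, 5119, 525311, 5119, 525311, 5119, 525311, 5119, 525311, 2229503]⟩,
    ⟨35071, 18480, 142960,
      [25816, 55365, 114912, 27958, 136322, 114357, 0, 83912, 21676, 1878, 29589, 331423],
      [2047, 5631, 2047, 5631, 2047, 5631, 100607, 2047, 2047, 100607, 2047, 5631]⟩,
    ⟨67839, 22176, 152176,
      [17218, 84416, 93353, 9466, 715359, 86841, 0, 713224, 65268, 5125, 17228, 172342],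
      [3071, 3071, 263167, 263167, 3071, 3071, 100607, 3071, 263167, 100607, 263167, 263167]⟩,
    ⟨8703, 27720, 130672,
      [0, 0, 17555, 0, 268571, 133978, 0, 174812, 251769, 296546, 152541, 528757],
      [9215, 9727, 9215, 12799, 9215, 9727, 74239, 9215, 9215, 9215, 9215, 9215]⟩,
    ⟨2559, 73920, 139376,
      [0, 19287, 167524, 17555, 122122, 25816, 17218, 97897, 0, 8479, 12876, 25271],
      [3071, 2047, 263167, 9215, 3071, 2047, 3071, 9215, 264703, 263167, 2047, 263167]⟩,
    ⟨4607, 73920, 182640,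
      [0, 0, 167524, 0, 261544, 25816, 178961, 122581, 59526, 179888, 725683, 146966],
      [5119, 5631, 263167, 12799, 263167, 5631, 5631, 263167, 263167, 5119, 263167, 263167]⟩,
    ⟨66047, 73920, 139632,
      [134259, 123793, 17218, 178961, 0, 173958, 475224, 367653, 65268, 174771, 46486, 181666],
      [3071, 5631, 3071, 5631, 74239, 132095, 5631, 3071, 3071, 3071, 3071, 132095]⟩,
    ⟨1535, 110880, 128880,
      [0, 19287, 0, 0, 142473, 12614, 123793, 8688, 218594, 17457, 37146, 31534],
      [2047, 2047, 5631, 9727, 2047, 9727, 5631, 525311, 2047, 33791, 33791, 525311]⟩,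
    ⟨1023, 221760, 138096,
      [0, 0, 0, 0, 4932, 0, 134259, 0, 0, 0, 134259, 115478],
      [2047, 3071, 5119, 9215, 9215, 33791, 3071, 132095, 263167, 525311, 263167, 2047]⟩]

/-- The orbits on 11-subsets, by increasing size; these are not extended further. -/
def level11 : List OrbitRow :=
  [
    ⟨312447, 672, 185680,
      [],
      []⟩,
    ⟨2229503, 672, 242000,
      [],
      []⟩,
    ⟨100607, 7392, 243280,
      [],
      []⟩,
    ⟨264703, 7392, 222800,
      [],
      []⟩,
    ⟨12799, 9240, 294480,
      [],
      []⟩,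
    ⟨74239, 9240, 220752,
      [],
      []⟩,
    ⟨9727, 27720, 202320,
      [],
      []⟩,
    ⟨5119, 36960, 262480,
      [],
      []⟩,
    ⟨132095, 36960, 220496,
      [],
      []⟩,
    ⟨33791, 44352, 211280,
      [],
      []⟩,
    ⟨525311, 44352, 216400,
      [],
      []⟩,
    ⟨5631, 73920, 256080,
      [],
      []⟩,
    ⟨9215, 73920, 219216,
      [],
      []⟩,
    ⟨2047, 110880, 217680,
      [],
      []⟩,
    ⟨3071, 110880, 226896,
      [],
      []⟩,
    ⟨263167, 110880, 263760,
      [],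
      []⟩]

theorem describesOrbits_level0 : DescribesOrbits 0 level0 := by
  have h : maskSet 0 = ∅ := by
    ext i
    simp
  constructor
  · rw [orbitPartition_zero]
    simp only [level0, List.map_cons, List.map_nil, h]
  · simp only [level0, List.mem_singleton, forall_eq, h]
    rw [Finset.card_eq_one]
    refine ⟨∅, ?_⟩
    ext Γ
    simp [mem_imagesOf, eq_comm]

theorem describesOrbits_level1 : DescribesOrbits 1 level1 :=
  describesOrbits_level0.succ (by decide +kernel)

theorem describesOrbits_level2 : DescribesOrbits 2 level2 :=
  describesOrbits_level1.succ (by decide +kernel)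

theorem describesOrbits_level3 : DescribesOrbits 3 level3 :=
  describesOrbits_level2.succ (by decide +kernel)

theorem describesOrbits_level4 : DescribesOrbits 4 level4 :=
  describesOrbits_level3.succ (by decide +kernel)

theorem describesOrbits_level5 : DescribesOrbits 5 level5 :=
  describesOrbits_level4.succ (by decide +kernel)

theorem describesOrbits_level6 : DescribesOrbits 6 level6 :=
  describesOrbits_level5.succ (by decide +kernel)

theorem describesOrbits_level7 : DescribesOrbits 7 level7 :=
  describesOrbits_level6.succ (by decide +kernel)

theorem describesOrbits_level8 : DescribesOrbits 8 level8 :=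
  describesOrbits_level7.succ (by decide +kernel)

theorem describesOrbits_level9 : DescribesOrbits 9 level9 :=
  describesOrbits_level8.succ (by decide +kernel)

theorem describesOrbits_level10 : DescribesOrbits 10 level10 :=
  describesOrbits_level9.succ (by decide +kernel)

theorem describesOrbits_level11 : DescribesOrbits 11 level11 :=
  describesOrbits_level10.succ (by decide +kernel)

theorem mainTheorem3 :
    (∀ k : ℕ, k ≤ 3 → orbitSizes mathieuM22 (Fin 22) k = {Nat.choose 22 k}) ∧
    orbitSizes mathieuM22 (Fin 22) 4 = {1155, 6160} ∧
    orbitSizes mathieuM22 (Fin 22) 5 = {462, 3696, 3696, 18480} ∧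
    orbitSizes mathieuM22 (Fin 22) 6 = {77, 1232, 1232, 7392, 9240, 55440} ∧
    orbitSizes mathieuM22 (Fin 22) 7 =
      {176, 176, 1232, 2640, 18480, 18480, 55440, 73920} ∧
    orbitSizes mathieuM22 (Fin 22) 8 =
      {330, 2640, 2640, 9240, 27720, 36960, 36960, 55440, 73920, 73920} ∧
    orbitSizes mathieuM22 (Fin 22) 9 =
      {4620, 6160, 18480, 18480, 18480, 24640, 36960, 36960, 110880, 221760} ∧
    orbitSizes mathieuM22 (Fin 22) 10 =
      {616, 2310, 6160, 7392, 7392, 18480, 22176, 27720, 73920, 73920, 73920, 110880, 221760} ∧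
    orbitSizes mathieuM22 (Fin 22) 11 =
      {672, 672, 7392, 7392, 9240, 9240, 27720, 36960, 36960, 44352, 44352, 73920, 73920,
        110880, 110880, 110880} ∧
    (∀ k : ℕ, k ≤ 22 →
      orbitSizes mathieuM22 (Fin 22) k = orbitSizes mathieuM22 (Fin 22) (22 - k)) := by
  refine ⟨fun k hk => ?_, describesOrbits_level4.orbitSizes_eq,
    describesOrbits_level5.orbitSizes_eq, describesOrbits_level6.orbitSizes_eq,
    describesOrbits_level7.orbitSizes_eq, describesOrbits_level8.orbitSizes_eq,
    describesOrbits_level9.orbitSizes_eq, describesOrbits_level10.orbitSizes_eq,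
    describesOrbits_level11.orbitSizes_eq, fun k hk => ?_⟩
  · interval_cases k
    · exact describesOrbits_level0.orbitSizes_eq
    · exact describesOrbits_level1.orbitSizes_eq
    · exact describesOrbits_level2.orbitSizes_eq
    · exact describesOrbits_level3.orbitSizes_eq
  · have h := orbitSizes_compl (G := mathieuM22) (Ω := Fin 22) (k := k)
    rw [Fintype.card_fin] at h
    exact h hk
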